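/- **Conventions.** For a commutative semiring $R$, $\mathsf{Mat}(R)$ is the category with objects the positive integers, morphisms $m\to n$ the $n\times m$ matrices over $R$, and matrix multiplication as composition; it is monoidal under the Kronecker product. For a number field $F$, $F^+$ is the semiring consisting of $0$ and the totally positive elements of $F$ (those that every real embedding of $F$ sends to a positive number). Let $K/k$ be a finite Galois extension with group $\Gamma$, which acts on $\mathsf{Mat}(K)$ by $\phi_g(M)=(g(M_{ij}))$, and let $S\subseteq K$ be a subsemiring. * *Folding*: $\mathrm{fld}(n)=n^{\otimes\Gamma}$, with basis the families $i=(i_g)_{g\in\Gamma}$ in $\{1,\dots,n\}$, and $\mathrm{fld}(f)=\bigotimes_{g\in\Gamma}\phi_g(f)$, so that $\mathrm{fld}(f)_{j,i}=\prod_{g}g(f_{j_g,i_g})$. * *Discarding*: for a subgroup $H\le\Gamma$, the $H$-discarding map is the effect $\mathrm{fld}(n)\to 1$ that takes the value $1$ on the families $i$ that are constant on every left coset $tH$, and $0$ on all other families. The environment structure $\Xi$ consists of the $H$-discarding maps for all $H\le\Gamma$ and all $n$, closed under tensor products $\xi_a\otimes\xi_b$, regarded as effects on $\mathrm{fld}(ab)\cong\mathrm{fld}(a)\otimes\mathrm{fld}(b)$.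 * *CPM category*: $\mathrm{CPM}[\mathsf{Mat}(S)]_{K/k}$ is the smallest subcategory of $\mathsf{Mat}(K)$, with objects the $\mathrm{fld}(n)$, $n\ge 1$, that contains $\mathrm{fld}(f)$ for all matrices $f$ over $S$ and the maps $\mathrm{fld}(ab)\cong\mathrm{fld}(a)\otimes\mathrm{fld}(b)\xrightarrow{\ \xi\otimes\mathrm{id}\ }\mathrm{fld}(b)$ for all $\xi\in\Xi_a$ and $b\ge 1$. * *Decoherence*: for an intermediate field $F$, the decoherence map $\mathrm{dec}^{K}_{F}$ on $\mathrm{fld}(n)$ is the idempotent of $\mathrm{CPM}[\mathsf{Mat}(K)]_{K/k}$ obtained by folding the copying map $|x\rangle\mapsto|x\rangle\otimes|x\rangle$ of the standard basis and applying the $\mathrm{Gal}(K/F)$-discarding map to one of the two copies. It is the diagonal projection onto the span of the basis families $i$ that are constant on every left coset of $\mathrm{Gal}(K/F)$. **Proposition.** Let $K=\mathbb{Q}(\zeta_5)$ with $\zeta_5$ a primitive fifth root of unity, so that $\mathbb{Q}\subset\mathbb{Q}(\sqrt5)\subset K$, and let $\mathsf{Quant}$ be the Karoubi envelope of $\mathrm{CPM}[\mathsf{Mat}(K)]_{K/\mathbb{Q}}$,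 with objects the pairs $(X,p)$ of an object $X$ and an idempotent $p$ on it. 1. The full subcategory of $\mathsf{Quant}$ on the objects $(\mathrm{fld}(n),\mathrm{dec}^{K}_{\mathbb{Q}})$, $n\ge1$, is equivalent to $\mathsf{Mat}(\mathbb{Q}^+)$. 2. The full subcategory of $\mathsf{Quant}$ on the objects $(\mathrm{fld}(n),\mathrm{dec}^{K}_{\mathbb{Q}(\sqrt5)})$, $n\ge1$, is equivalent to $\mathrm{CPM}[\mathsf{Mat}(\mathbb{Q}(\sqrt5)^+)]_{\mathbb{Q}(\sqrt5)/\mathbb{Q}}$. -/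

import Mathlib

open CategoryTheory

noncomputable section

namespace GaloisCPM

/-- The semiring `F⁺` of totally positive elements of a number field `F`, with `0` included: those
elements which no real embedding of `F` sends to a negative number. -/
def totallyPositive (F : Type*) [Field F] : Subsemiring F where
  carrier := {x | ∀ σ : F →+* ℝ, 0 ≤ σ x}
  mul_mem' := fun ha hb σ => by
    rw [map_mul]
    exact mul_nonneg (ha σ) (hb σ)
  one_mem' := fun σ => by simp
  add_mem' := fun ha hb σ => by
    rw [map_add]
    exact add_nonneg (ha σ) (hb σ)
  zero_mem' := fun σ => by simp

theorem mem_totallyPositive_iff {F : Type*} [Field F] (x : F) :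
    x ∈ totallyPositive F ↔ x = 0 ∨ ∀ σ : F →+* ℝ, 0 < σ x := by
  constructor
  · intro h
    by_cases hx : x = 0
    · exact Or.inl hx
    · exact Or.inr fun σ => lt_of_le_of_ne (h σ) fun h0 => hx ((map_eq_zero σ).1 h0.symm)
  · rintro (rfl | h) σ
    · simp
    · exact (h σ).le

/-- The category `Mat(R)` of matrices over a commutative semiring: its objects are the positive
natural numbers. -/
@[ext]
structure MatCat (R : Type*) where
  /-- the underlying positive natural number -/
  dim : ℕ+

/-- Morphisms `m ⟶ n` are the `n × m` matrices, composition is the product of matrices. -/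
instance (R : Type*) [CommSemiring R] : Category (MatCat R) where
  Hom m n := Matrix (Fin n.dim) (Fin m.dim) R
  id m := (1 : Matrix (Fin m.dim) (Fin m.dim) R)
  comp {m n p} f g :=
    (show Matrix (Fin p.dim) (Fin n.dim) R from g) * (show Matrix (Fin n.dim) (Fin m.dim) R from f)
  id_comp _ := Matrix.mul_one _
  comp_id _ := Matrix.one_mul _
  assoc _ _ _ := (Matrix.mul_assoc _ _ _).symm

/-- The standard basis of `a ⊗ b = a * b` consists of the pairs of basis elements. -/
def pairEquiv (a b : ℕ+) : Fin (a * b : ℕ+) ≃ Fin a × Fin b :=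
  (finCongr (PNat.mul_coe a b)).trans finProdFinEquiv.symm

section Fields

variable (k K : Type*) [Field k] [Field K] [Algebra k K]

/-- A basis element of the folding `⨂_{g ∈ Γ} φ_g(n)` of the object `n`, `Γ = Gal(K/k)`: a family
of basis elements of `n` indexed by the Galois group. -/
abbrev FoldIdx (n : ℕ+) : Type _ := (K ≃ₐ[k] K) → Fin n

variable {k K}

/-- Equality in the Galois group is decided classically. -/
instance : DecidableEq (K ≃ₐ[k] K) := Classical.decEq _

variable [FiniteDimensional k K]

/-- First component of a basis element of `fld (a ⊗ b) ≅ fld a ⊗ fld b`. -/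
def FoldIdx.fst {a b : ℕ+} (i : FoldIdx k K (a * b)) : FoldIdx k K a :=
  fun g => (pairEquiv a b (i g)).1

/-- Second component of a basis element of `fld (a ⊗ b) ≅ fld a ⊗ fld b`. -/
def FoldIdx.snd {a b : ℕ+} (i : FoldIdx k K (a * b)) : FoldIdx k K b :=
  fun g => (pairEquiv a b (i g)).2

open scoped Classical in
/-- The discarding map `fld n → I` of a subgroup `H` with respect to the standard basis: the
tensor product over the left cosets of `H` of the effects (spiders) which are `1` on
`|x⟩ ⊗ ⋯ ⊗ |x⟩` and `0` on the other basis elements. So it is `1` on the families of basis elements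
which are constant on each left coset of `H`, and `0` on the others. -/
def discard (H : Subgroup (K ≃ₐ[k] K)) (n : ℕ+) : FoldIdx k K n → K :=
  fun i => if ∀ g, ∀ h ∈ H, i (g * h) = i g then 1 else 0

/-- The tensor product `(ξ ⊗ ζ) ∘ π⁻¹` of two effects. -/
def effectTensor {a b : ℕ+} (ξ : FoldIdx k K a → K) (ζ : FoldIdx k K b → K) :
    FoldIdx k K (a * b) → K :=
  fun i => ξ i.fst * ζ i.snd

/-- The environment structure: the discarding maps of all subgroups of the Galois group, closed
under the tensor product. -/
inductive IsEnv : ∀ {n : ℕ+}, (FoldIdx k K n → K) → Prop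
  | discard (H : Subgroup (K ≃ₐ[k] K)) (n : ℕ+) : IsEnv (discard H n)
  | tensor {a b : ℕ+} {ξ : FoldIdx k K a → K} {ζ : FoldIdx k K b → K} :
      IsEnv ξ → IsEnv ζ → IsEnv (effectTensor ξ ζ)

/-- The monoidal product `(ξ ⊗ id) ∘ π⁻¹ : fld (a ⊗ b) → fld b` of an effect `ξ` on `fld a` with
the identity of `fld b`. -/
def effectTensorId {a : ℕ+} (ξ : FoldIdx k K a → K) (b : ℕ+) :
    Matrix (FoldIdx k K b) (FoldIdx k K (a * b)) K :=
  Matrix.of fun j i => ξ i.fst * (if i.snd = j then 1 else 0)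

/-- The comultiplication `n → n ⊗ n`, `|x⟩ ↦ |x⟩ ⊗ |x⟩` of the classical structure defined by the
standard basis. -/
def copyMatrix (K : Type*) [Field K] (n : ℕ+) : Matrix (Fin (n * n : ℕ+)) (Fin n) K :=
  Matrix.of fun p i => if pairEquiv n n p = (i, i) then 1 else 0

/-- The decoherence map of `H` on `fld n`: on each left coset of `H` it is the spider with as many
inputs and as many outputs as the coset has elements. So it is the diagonal matrix which keeps the
families of basis elements that are constant on each left coset of `H`. -/
def decoherence (H : Subgroup (K ≃ₐ[k] K)) (n : ℕ+) :
    Matrix (FoldIdx k K n) (FoldIdx k K n) K :=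
  Matrix.diagonal (discard H n)

open scoped Classical in
/-- The entries of the decoherence map are those of a tensor product of spiders: the entry is `1` if
on each left coset all inputs and outputs agree, and `0` otherwise. -/
theorem decoherence_apply (H : Subgroup (K ≃ₐ[k] K)) (n : ℕ+) (j i : FoldIdx k K n) :
    decoherence H n j i = if ∀ g, ∀ h ∈ H, ∀ h' ∈ H, i (g * h) = j (g * h') then 1 else 0 := by
  unfold decoherence discard
  rw [Matrix.diagonal_apply]
  by_cases hji : j = i
  · subst hji
    rw [if_pos rfl]
    congr 1
    apply propext
    constructor
    · intro h g x hx y hy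
      rw [h g x hx, h g y hy]
    · intro h g x hx
      simpa using h g x hx 1 H.one_mem
  · rw [if_neg hji, if_neg]
    intro h
    apply hji
    funext g
    simpa using (h g 1 H.one_mem 1 H.one_mem).symm

/-- The complete folding functor `f ↦ ⨂_{g ∈ Γ} φ_g(f)` on matrices: the tensor product over the
Galois group of the matrices obtained by applying the automorphisms to the entries. -/
def foldMatrix {n m : ℕ+} (f : Matrix (Fin m) (Fin n) K) :
    Matrix (FoldIdx k K m) (FoldIdx k K n) K :=
  Matrix.of fun j i => ∏ g : K ≃ₐ[k] K, g (f (j g) (i g))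

variable (k) in
/-- The morphisms `fld n → fld m` of the category `CPM[Mat(S)]` for the extension `K/k` and a
subsemiring `S` of `K`: the smallest class of matrices which contains the foldings of the matrices
over `S` and the products of the effects of the environment structure with identities, and which
is closed under composition. -/
inductive IsCPM (S : Subsemiring K) :
    ∀ {n m : ℕ+}, Matrix (FoldIdx k K m) (FoldIdx k K n) K → Prop
  | fold {n m : ℕ+} (f : Matrix (Fin m) (Fin n) K) (hf : ∀ j i, f j i ∈ S) :
      IsCPM S (foldMatrix f)
  | effect {a : ℕ+} {ξ : FoldIdx k K a → K} (hξ : IsEnv ξ) (b : ℕ+) :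
      IsCPM S (effectTensorId ξ b)
  | comp {n m p : ℕ+} {f : Matrix (FoldIdx k K m) (FoldIdx k K n) K}
      {g : Matrix (FoldIdx k K p) (FoldIdx k K m) K} :
      IsCPM S f → IsCPM S g → IsCPM S (g * f)

theorem foldMatrix_one (n : ℕ+) :
    foldMatrix (1 : Matrix (Fin n) (Fin n) K) = (1 : Matrix (FoldIdx k K n) (FoldIdx k K n) K) := by
  ext j i
  simp only [foldMatrix, Matrix.of_apply, Matrix.one_apply]
  by_cases h : j = i
  · subst h
    simp
  · rw [if_neg h]
    obtain ⟨g, hg⟩ := Function.ne_iff.1 h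
    exact Finset.prod_eq_zero (Finset.mem_univ g) (by rw [if_neg hg, map_zero])

theorem isCPM_one (S : Subsemiring K) (n : ℕ+) :
    IsCPM k S (1 : Matrix (FoldIdx k K n) (FoldIdx k K n) K) := by
  rw [← foldMatrix_one]
  refine IsCPM.fold _ fun j i => ?_
  rw [Matrix.one_apply]
  split_ifs
  exacts [S.one_mem, S.zero_mem]

/-- Decoherence is copying followed by discarding one of the two copies. -/
theorem decoherence_eq (H : Subgroup (K ≃ₐ[k] K)) (n : ℕ+) :
    decoherence H n = effectTensorId (discard H n) n * foldMatrix (copyMatrix K n) := by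
  ext j i
  have key : ∀ p : FoldIdx k K (n * n),
      foldMatrix (k := k) (copyMatrix K n) p i =
        if p = fun g => (pairEquiv n n).symm (i g, i g) then 1 else 0 := by
    intro p
    simp only [foldMatrix, copyMatrix, Matrix.of_apply]
    by_cases h : p = fun g => (pairEquiv n n).symm (i g, i g)
    · subst h
      rw [if_pos rfl]
      exact Finset.prod_eq_one fun g _ => by
        rw [if_pos (Equiv.apply_symm_apply (pairEquiv n n) _), map_one]
    · rw [if_neg h]
      obtain ⟨g, hg⟩ := Function.ne_iff.1 h
      refine Finset.prod_eq_zero (Finset.mem_univ g) ?_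
      rw [if_neg, map_zero]
      intro h'
      exact hg ((Equiv.eq_symm_apply _).2 h')
  refine Eq.trans ?_ (Matrix.mul_apply (M := effectTensorId (discard H n) n)).symm
  simp only [key, mul_ite, mul_one, mul_zero, Finset.sum_ite_eq', Finset.mem_univ, if_true]
  have h1 : FoldIdx.fst (k := k) (K := K) (fun g => (pairEquiv n n).symm (i g, i g)) = i := by
    funext g
    exact congrArg (fun q => q.1) (Equiv.apply_symm_apply (pairEquiv n n) (i g, i g))
  have h2 : FoldIdx.snd (k := k) (K := K) (fun g => (pairEquiv n n).symm (i g, i g)) = i := by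
    funext g
    exact congrArg (fun q => q.2) (Equiv.apply_symm_apply (pairEquiv n n) (i g, i g))
  simp only [effectTensorId, Matrix.of_apply, h1, h2, decoherence, Matrix.diagonal_apply]
  by_cases h : j = i
  · subst h
    simp
  · rw [if_neg h, if_neg (Ne.symm h), mul_zero]

theorem isCPM_decoherence (S : Subsemiring K) (H : Subgroup (K ≃ₐ[k] K)) (n : ℕ+) :
    IsCPM k S (decoherence H n) := by
  rw [decoherence_eq]
  refine IsCPM.comp (IsCPM.fold _ fun p i => ?_) (IsCPM.effect (IsEnv.discard H n) n)
  simp only [copyMatrix, Matrix.of_apply]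
  split_ifs
  exacts [S.one_mem, S.zero_mem]

theorem decoherence_mul_self (H : Subgroup (K ≃ₐ[k] K)) (n : ℕ+) :
    decoherence H n * decoherence H n = decoherence H n := by
  unfold decoherence
  rw [Matrix.diagonal_mul_diagonal]
  congr 1
  funext i
  unfold discard
  split_ifs <;> simp

/-- The category `CPM[Mat(S)]` for the extension `K/k` and a subsemiring `S` of `K`. Its objects are
the foldings `fld n` of the objects `n` of `Mat(S)`, and are represented by `n`. -/
@[ext]
structure CPM (k : Type*) {K : Type*} [Field k] [Field K] [Algebra k K] (S : Subsemiring K) where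
  /-- the number `n` of which the object is the folding -/
  dim : ℕ+

instance (S : Subsemiring K) : Category (CPM k S) where
  Hom X Y := {f : Matrix (FoldIdx k K Y.dim) (FoldIdx k K X.dim) K // IsCPM k S f}
  id X := ⟨1, isCPM_one S X.dim⟩
  comp f g := ⟨g.1 * f.1, f.2.comp g.2⟩
  id_comp _ := Subtype.ext (Matrix.mul_one _)
  comp_id _ := Subtype.ext (Matrix.one_mul _)
  assoc _ _ _ := Subtype.ext (Matrix.mul_assoc _ _ _).symm

variable (k K) in
/-- The Karoubi envelope of the Galois CPM category of the extension `K/k`. -/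
abbrev Quant := Idempotents.Karoubi (CPM k (⊤ : Subsemiring K))

/-- The decoherence map from `K` to an intermediate field `F` on `fld n`, i.e. the one of the
subgroup `Gal(K/F)`, as an object of the Karoubi envelope. -/
def decoherenceObj (F : IntermediateField k K) (n : ℕ+) : Quant k K where
  X := ⟨n⟩
  p := ⟨decoherence F.fixingSubgroup n, isCPM_decoherence ⊤ F.fixingSubgroup n⟩
  idem := Subtype.ext (decoherence_mul_self F.fixingSubgroup n)

/-- The property of being one of the decoherence maps from `K` to `F`. -/
def IsDecoherence (F : IntermediateField k K) : ObjectProperty (Quant k K) :=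
  fun X => ∃ n : ℕ+, X = decoherenceObj F n

end Fields

end GaloisCPM

end

/-! A morphism between decohered objects is determined by its entries at the families constant on
the cosets of `Gal(K/E)`, so each claim asks which matrices arise by restricting CPM morphisms to
these families (`nonempty_decoherence_equivalence`).

Let `F = ℚ(√5)`. As `Γ ≅ (ℤ/5)ˣ` has order 4 and a single involution, its only subgroups are `1`,
`Gal(K/F)` and `Γ`. Hence every CPM morphism has a Kraus form (`IsCPM.hasKrausForm`), with one index
`z` for all of `Γ` and an index `y` for each coset of `Gal(K/F)`. At families lifted from `Gal(F/ℚ)`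
its entries are `∑_z ∏_t t(∑_y N_{K/F}(f_{z,y}))`, with `t` in `Gal(F/ℚ)`. Norms from the totally
complex `K` are totally positive, so this is a sum of foldings of matrices over `F⁺`, and such a sum
comes from discarding with respect to the full group. At constant families the product over `t`
becomes `N_{F/ℚ}`, giving nonnegative rationals.

Conversely, totally positive elements of `F` are sums of squares, hence of norms `N_{K/F}(v) = v²`
with `v` in `F`, and discarding with respect to `Gal(K/F)` produces such sums (`IsCPM.exists_lift`).
Nonnegative rationals are sums of fourth powers, which are the values of foldings of rationals at
constant families. -/

noncomputable section

namespace GaloisCPM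

/-! ### Restriction of automorphisms and norms in a tower `k ⊆ F ⊆ K`. -/

section Tower

variable {k F K : Type*} [Field k] [Field F] [Field K] [Algebra k F] [Algebra F K] [Algebra k K]
  [IsScalarTower k F K] [Normal k F]

theorem algebraMap_restrictNormalHom (g : K ≃ₐ[k] K) (x : F) :
    algebraMap F K (AlgEquiv.restrictNormalHom F g x) = g (algebraMap F K x) :=
  AlgEquiv.restrictNormal_commutes g F x

/-- The family of basis elements on `Gal(K/k)` obtained from one on `Gal(F/k)` by restricting
automorphisms to `F`. -/
def FoldIdx.lift (K : Type*) [Field K] [Algebra F K] [Algebra k K] [IsScalarTower k F K] {n : ℕ+}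
    (i : FoldIdx k F n) : FoldIdx k K n :=
  fun g => i (AlgEquiv.restrictNormalHom F g)

variable [Normal k K]

theorem FoldIdx.lift_injective {n : ℕ+} :
    Function.Injective (FoldIdx.lift (k := k) (F := F) K (n := n)) := by
  intro i j h
  funext t
  obtain ⟨g, rfl⟩ := AlgEquiv.restrictNormalHom_surjective (F := k) (K₁ := F) K t
  exact congrFun h g

/-- A family is constant on the fibres of a homomorphism from the Galois group onto `Gal(F/k)` if
and only if it is lifted from `Gal(F/k)`. -/
theorem FoldIdx.exists_lift_eq_iff {n : ℕ+} (i : FoldIdx k K n) :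
    (∃ j : FoldIdx k F n, j.lift K = i) ↔
      ∀ g, ∀ h ∈ (AlgEquiv.restrictNormalHom F : (K ≃ₐ[k] K) →* (F ≃ₐ[k] F)).ker, i (g * h) = i g := by
  constructor
  · rintro ⟨j, rfl⟩ g h hh
    simp only [FoldIdx.lift, map_mul, MonoidHom.mem_ker.1 hh, mul_one]
  · intro h
    have hs := AlgEquiv.restrictNormalHom_surjective (F := k) (K₁ := F) K
    refine ⟨fun t => i (Function.surjInv hs t), funext fun g => ?_⟩
    have := h (Function.surjInv hs (AlgEquiv.restrictNormalHom F g))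
      ((Function.surjInv hs (AlgEquiv.restrictNormalHom F g))⁻¹ * g) (by
        rw [MonoidHom.mem_ker, map_mul, map_inv, Function.surjInv_eq hs, inv_mul_cancel])
    rw [mul_inv_cancel_left] at this
    exact this.symm

variable [FiniteDimensional k K]

/-- The product of the conjugates of `w` under the extensions of `t` is the image of the relative
norm of `w` under `t`. -/
theorem prod_extensions_eq_norm [FiniteDimensional F K] [IsGalois F K] [DecidableEq (F ≃ₐ[k] F)]
    (t : F ≃ₐ[k] F) (w : K) :
    ∏ g : K ≃ₐ[k] K with AlgEquiv.restrictNormalHom F g = t, g w =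
      algebraMap F K (t (Algebra.norm F w)) := by
  obtain ⟨g₀, rfl⟩ := AlgEquiv.restrictNormalHom_surjective (F := k) (K₁ := F) K t
  rw [algebraMap_restrictNormalHom, Algebra.norm_eq_prod_automorphisms, map_prod]
  symm
  -- The automorphisms with the same restriction to `F` as `g₀` form the coset `g₀ Gal(K/F)`.
  refine Finset.prod_bij (fun σ _ => g₀ * σ.restrictScalars k) ?_ ?_ ?_ ?_
  · intro σ _
    rw [Finset.mem_filter]
    refine ⟨Finset.mem_univ _, AlgEquiv.ext fun x => (algebraMap F K).injective ?_⟩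
    rw [algebraMap_restrictNormalHom, algebraMap_restrictNormalHom, AlgEquiv.mul_apply,
      AlgEquiv.restrictScalars_apply, σ.commutes]
  · intro σ _ τ _ h
    ext x
    exact AlgEquiv.congr_fun (mul_left_cancel h) x
  · intro g hg
    have hg := (Finset.mem_filter.1 hg).2
    refine ⟨AlgEquiv.ofRingEquiv (f := (g₀⁻¹ * g).toRingEquiv) fun x => ?_, Finset.mem_univ _, ?_⟩
    · change (g₀⁻¹ * g) _ = _
      rw [← algebraMap_restrictNormalHom, map_mul, map_inv, hg, inv_mul_cancel, AlgEquiv.one_apply]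
    · refine (congrArg (g₀ * ·) ?_).trans (mul_inv_cancel_left g₀ g)
      ext x
      rfl
  · intro σ _
    rfl

theorem prod_galois_eq_prod_norm [FiniteDimensional k F] [FiniteDimensional F K] [IsGalois F K]
    (w : (F ≃ₐ[k] F) → K) :
    ∏ g : K ≃ₐ[k] K, g (w (AlgEquiv.restrictNormalHom F g)) =
      algebraMap F K (∏ t : F ≃ₐ[k] F, t (Algebra.norm F (w t))) := by
  rw [map_prod, ← Finset.prod_fiberwise Finset.univ (AlgEquiv.restrictNormalHom F)]
  refine Finset.prod_congr rfl fun t _ => ?_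
  rw [← prod_extensions_eq_norm]
  exact Finset.prod_congr rfl fun g hg => by rw [(Finset.mem_filter.1 hg).2]

/-- The index `y` is chosen independently for each `t`, so the sum over all choices is an expanded
product of sums. This evaluates a Kraus form at lifted families. -/
theorem sum_prod_galois_eq_prod_sum_norm [FiniteDimensional k F] [FiniteDimensional F K]
    [IsGalois F K] {Y : Type*} [Fintype Y] (w : Y → (F ≃ₐ[k] F) → K) :
    ∑ y : (F ≃ₐ[k] F) → Y, ∏ g : K ≃ₐ[k] K,
        g (w (y (AlgEquiv.restrictNormalHom F g)) (AlgEquiv.restrictNormalHom F g)) =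
      algebraMap F K (∏ t : F ≃ₐ[k] F, t (∑ y, Algebra.norm F (w y t))) := by
  simp_rw [map_sum]
  rw [Fintype.prod_sum, map_sum]
  exact Finset.sum_congr rfl fun y _ => prod_galois_eq_prod_norm fun t => w (y t) t

end Tower

/-! ### Basis families of a tensor product. -/

section Folding

variable {k K : Type*} [Field k] [Field K] [Algebra k K]

/-- A basis element of `fld (a ⊗ b)` from basis elements of `fld a` and `fld b`. -/
def FoldIdx.pair {a b : ℕ+} (e : FoldIdx k K a) (j : FoldIdx k K b) : FoldIdx k K (a * b) :=
  fun g => (pairEquiv a b).symm (e g, j g)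

theorem FoldIdx.sum_pair [FiniteDimensional k K] {a b : ℕ+} {R : Type*} [AddCommMonoid R]
    (f : FoldIdx k K (a * b) → R) :
    ∑ p, f p = ∑ e : FoldIdx k K a, ∑ j : FoldIdx k K b, f (e.pair j) := by
  rw [← Fintype.sum_prod_type']
  refine Fintype.sum_equiv ((Equiv.arrowCongr (Equiv.refl _) (pairEquiv a b)).trans
    (Equiv.arrowProdEquivProdArrow _ _ _)) _ _ fun p => congrArg f ?_
  funext g
  exact ((pairEquiv a b).symm_apply_apply (p g)).symm

@[simp]
theorem FoldIdx.fst_pair {a b : ℕ+} (e : FoldIdx k K a) (j : FoldIdx k K b) :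
    (e.pair j).fst = e := by
  funext g
  exact congrArg Prod.fst ((pairEquiv a b).apply_symm_apply (e g, j g))

@[simp]
theorem FoldIdx.snd_pair {a b : ℕ+} (e : FoldIdx k K a) (j : FoldIdx k K b) :
    (e.pair j).snd = j := by
  funext g
  exact congrArg Prod.snd ((pairEquiv a b).apply_symm_apply (e g, j g))

variable [FiniteDimensional k K]

theorem effectTensorId_mul_apply {a b n : ℕ+} (ξ : FoldIdx k K a → K)
    (M : Matrix (FoldIdx k K (a * b)) (FoldIdx k K n) K) (j : FoldIdx k K b) (i : FoldIdx k K n) :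
    (effectTensorId ξ b * M) j i = ∑ e : FoldIdx k K a, ξ e * M (e.pair j) i := by
  rw [Matrix.mul_apply, FoldIdx.sum_pair]
  refine Finset.sum_congr rfl fun e _ => ?_
  simp [effectTensorId]

end Folding

end GaloisCPM

end

noncomputable section

namespace GaloisCPM

/-! ### Discarding maps as sums over parametrized families. -/

section Discard

variable {k K : Type*} [Field k] [Field K] [Algebra k K]

variable (k K) in
/-- The constant families of basis elements. -/
def FoldIdx.const {n : ℕ+} (x : Fin n) :
    FoldIdx k K n :=
  fun _ => x

theorem FoldIdx.const_injective {n : ℕ+} :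
    Function.Injective (FoldIdx.const k K : Fin n → FoldIdx k K n) :=
  fun _ _ h => congrFun h 1

theorem FoldIdx.exists_const_eq_iff {n : ℕ+} (i : FoldIdx k K n) :
    (∃ x, FoldIdx.const k K x = i) ↔
      ∀ g, ∀ h ∈ (⊤ : Subgroup (K ≃ₐ[k] K)), i (g * h) = i g := by
  constructor
  · rintro ⟨x, rfl⟩ g h _
    rfl
  · intro h
    refine ⟨i 1, funext fun g => ?_⟩
    simpa [FoldIdx.const] using (h 1 g trivial).symm

variable [FiniteDimensional k K]

/-- `emb` parametrizes the support of the discarding map. It is applied both to constant families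
and to families lifted from `Gal(F/k)`. -/
theorem sum_discard_mul {H : Subgroup (K ≃ₐ[k] K)} {n : ℕ+} {J : Type*} [Fintype J]
    {emb : J → FoldIdx k K n} (hinj : Function.Injective emb)
    (hemb : ∀ i, (∃ j, emb j = i) ↔ ∀ g, ∀ h ∈ H, i (g * h) = i g) (φ : FoldIdx k K n → K) :
    ∑ i, discard H n i * φ i = ∑ j, φ (emb j) := by
  classical
  rw [← Finset.sum_image (s := Finset.univ) (g := emb) (f := φ) fun _ _ _ _ h => hinj h]
  symm
  refine Finset.sum_subset_zero_on_sdiff (Finset.subset_univ _) ?_ ?_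
  · intro i hi
    rw [discard, if_neg, zero_mul]
    intro h
    obtain ⟨j, rfl⟩ := (hemb i).2 h
    exact (Finset.mem_sdiff.1 hi).2 (Finset.mem_image_of_mem _ (Finset.mem_univ _))
  · intro i hi
    obtain ⟨j, _, rfl⟩ := Finset.mem_image.1 hi
    rw [discard, if_pos ((hemb _).1 ⟨j, rfl⟩), one_mul]

theorem discard_eq_sum {H : Subgroup (K ≃ₐ[k] K)} {n : ℕ+} {J : Type*} [Fintype J]
    {emb : J → FoldIdx k K n} (hinj : Function.Injective emb)
    (hemb : ∀ i, (∃ j, emb j = i) ↔ ∀ g, ∀ h ∈ H, i (g * h) = i g) (i : FoldIdx k K n) :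
    discard H n i = ∑ j, ∏ g, if emb j g = i g then 1 else 0 := by
  rw [← sum_discard_mul hinj hemb fun e => ∏ g, if e g = i g then 1 else 0]
  symm
  refine (Finset.sum_eq_single i ?_ (by simp)).trans (by simp)
  intro e _ he
  obtain ⟨g, hg⟩ := Function.ne_iff.1 he
  rw [Finset.prod_eq_zero (Finset.mem_univ g) (if_neg hg), mul_zero]

theorem discard_bot (n : ℕ+) (i : FoldIdx k K n) : discard ⊥ n i = 1 := by
  rw [discard, if_pos]
  rintro g h rfl
  rw [mul_one]

/-- Sums of foldings are obtained by discarding with respect to the full Galois group. -/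
theorem isCPM_sum_foldMatrix {S : Subsemiring K} {m n : ℕ+} {Z : Type} [Fintype Z] [Nonempty Z]
    (f : Z → Matrix (Fin m) (Fin n) K) (hf : ∀ z j i, f z j i ∈ S) :
    IsCPM k S (∑ z, foldMatrix (k := k) (f z)) := by
  let a : ℕ+ := ⟨Fintype.card Z, Fintype.card_pos⟩
  let e : Fin a ≃ Z := (Fintype.equivFin Z).symm
  -- The matrices are stacked, with `z` as an extra output. Discarding this output forces the same
  -- `z` at every automorphism, which leaves the sum of the foldings.
  let f' : Matrix (Fin (a * m : ℕ+)) (Fin n) K :=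
    Matrix.of fun p i => f (e (pairEquiv a m p).1) (pairEquiv a m p).2 i
  have key : ∑ z, foldMatrix (k := k) (f z) =
      effectTensorId (discard ⊤ a) m * foldMatrix f' := by
    ext j i
    refine Eq.trans ?_ (effectTensorId_mul_apply _ _ _ _).symm
    refine (Matrix.sum_apply j i Finset.univ fun z => foldMatrix (k := k) (f z)).trans ?_
    rw [sum_discard_mul FoldIdx.const_injective FoldIdx.exists_const_eq_iff]
    refine (Fintype.sum_equiv e _ _ fun x => ?_).symm
    simp only [foldMatrix, Matrix.of_apply, f']
    refine Finset.prod_congr rfl fun g _ => ?_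
    rw [show pairEquiv a m ((FoldIdx.const k K x).pair j g) = (x, j g) from
      (pairEquiv a m).apply_symm_apply _]
  rw [key]
  exact (IsCPM.fold f' fun _ _ => hf _ _ _).comp (IsCPM.effect (IsEnv.discard ⊤ a) m)

end Discard

/-! ### Splitting the decoherence idempotents. -/

section Equivalence

variable {k K : Type*} [Field k] [Field K] [Algebra k K] [FiniteDimensional k K]

/-- A category of matrices, which are those obtained from the matrices of `CPM[Mat(K)]` by
restriction to the families of basis elements that are constant on the left cosets of `Gal(K/E)`,
is equivalent to the full subcategory of `Quant` on the decoherence maps from `K` to `E`. -/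
theorem nonempty_decoherence_equivalence (E : IntermediateField k K) {C : Type*} [Category C]
    (dim : C → ℕ+) (hdim : Function.Surjective dim) {J : ℕ+ → Type*} [∀ n, Fintype (J n)]
    [∀ n, DecidableEq (J n)] (emb : ∀ n, J n → FoldIdx k K n)
    (hinj : ∀ n, Function.Injective (emb n))
    (hemb : ∀ n i, (∃ j, emb n j = i) ↔ ∀ g, ∀ h ∈ E.fixingSubgroup, i (g * h) = i g)
    (mat : ∀ {X Y : C}, (X ⟶ Y) → Matrix (J (dim Y)) (J (dim X)) K)
    (mat_injective : ∀ {X Y : C}, Function.Injective (mat (X := X) (Y := Y)))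
    (mat_id : ∀ X : C, mat (𝟙 X) = 1)
    (mat_comp : ∀ {X Y Z : C} (f : X ⟶ Y) (g : Y ⟶ Z), mat (f ≫ g) = mat g * mat f)
    (exists_isCPM : ∀ {X Y : C} (f : X ⟶ Y),
      ∃ M, IsCPM k ⊤ M ∧ M.submatrix (emb _) (emb _) = mat f)
    (exists_hom : ∀ {X Y : C} (M : Matrix (FoldIdx k K (dim Y)) (FoldIdx k K (dim X)) K),
      IsCPM k ⊤ M → ∃ f : X ⟶ Y, mat f = M.submatrix (emb _) (emb _)) :
    Nonempty ((IsDecoherence E).FullSubcategory ≌ C) := by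
  -- `V` includes the span of the coset-constant families. It splits decoherence: `Vᵀ V = 1` and `V
  -- Vᵀ` is the idempotent.
  let V (n : ℕ+) : Matrix (FoldIdx k K n) (J n) K :=
    Matrix.of fun i j => if emb n j = i then 1 else 0
  have hVV (n : ℕ+) : (V n).transpose * V n = 1 := by
    ext i j
    simp [V, Matrix.mul_apply, Matrix.one_apply, (hinj n).eq_iff, eq_comm]
  have hVM {m n : ℕ+} (M : Matrix (FoldIdx k K m) (FoldIdx k K n) K) :
      (V m).transpose * M * V n = M.submatrix (emb m) (emb n) := by
    ext i j
    simp [V, Matrix.mul_apply]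
  have hD (n : ℕ+) : V n * (V n).transpose = decoherence E.fixingSubgroup n := by
    ext i j
    have := sum_discard_mul (hinj n) (hemb n)
      fun e => (if e = i then (1 : K) else 0) * if e = j then 1 else 0
    simp only [Matrix.mul_apply, V, Matrix.of_apply, Matrix.transpose_apply, decoherence,
      Matrix.diagonal_apply]
    rw [← this]
    by_cases h : i = j
    · simp [h]
    · simp [h, Ne.symm h]
  let ext {m n : ℕ+} (A : Matrix (J m) (J n) K) := V m * A * (V n).transpose
  have ext_sub {m n : ℕ+} (M : Matrix (FoldIdx k K m) (FoldIdx k K n) K) :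
      ext (M.submatrix (emb m) (emb n)) =
        decoherence E.fixingSubgroup m * M * decoherence E.fixingSubgroup n := by
    simp only [ext, ← hVM, ← hD, Matrix.mul_assoc]
  have ext_mul {l m n : ℕ+} (A : Matrix (J l) (J m) K) (B : Matrix (J m) (J n) K) :
      ext A * ext B = ext (A * B) := by
    simp only [ext, Matrix.mul_assoc]
    rw [← Matrix.mul_assoc (V m).transpose, hVV, Matrix.one_mul]
  have ext_one (n : ℕ+) : ext (1 : Matrix (J n) (J n) K) = decoherence E.fixingSubgroup n := by
    simp only [ext, Matrix.mul_one, hD]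
  have ext_comm {m n : ℕ+} (A : Matrix (J m) (J n) K) :
      decoherence E.fixingSubgroup m * ext A * decoherence E.fixingSubgroup n = ext A := by
    rw [← ext_one, ← ext_one, ext_mul, ext_mul, Matrix.one_mul, Matrix.mul_one]
  have sub_ext {m n : ℕ+} (A : Matrix (J m) (J n) K) :
      (V m).transpose * ext A * V n = A := by
    simp only [ext, Matrix.mul_assoc, hVV, Matrix.mul_one]
    rw [← Matrix.mul_assoc, hVV, Matrix.one_mul]
  -- The given `M` may have entries outside the coset-constant families; decoherence on both sides
  -- removes them and stays in the CPM category.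
  have ext_cpm {X Y : C} (f : X ⟶ Y) : IsCPM k (⊤ : Subsemiring K) (ext (mat f)) := by
    obtain ⟨M, hM, h⟩ := exists_isCPM f
    rw [← h, ext_sub]
    exact (isCPM_decoherence _ _ _).comp (hM.comp (isCPM_decoherence _ _ _))
  let Φ : C ⥤ (IsDecoherence E).FullSubcategory :=
    { obj := fun X => ⟨decoherenceObj E (dim X), dim X, rfl⟩
      map := fun {X Y} f => ObjectProperty.homMk
        { f := ⟨ext (mat f), ext_cpm f⟩
          comm := Subtype.ext (ext_comm (mat f)) }
      map_id := fun X => by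
        apply ObjectProperty.hom_ext
        apply Idempotents.Karoubi.Hom.ext
        apply Subtype.ext
        change ext (mat (𝟙 X)) = decoherence _ _
        rw [mat_id, ext_one]
      map_comp := fun f g => by
        apply ObjectProperty.hom_ext
        apply Idempotents.Karoubi.Hom.ext
        apply Subtype.ext
        change ext (mat (f ≫ g)) = ext (mat g) * ext (mat f)
        rw [mat_comp, ext_mul] }
  have : Φ.Faithful := ⟨fun {X Y f g} h => by
    have h' : ext (mat f) = ext (mat g) := congrArg (fun u => u.hom.f.1) h
    apply mat_injective
    rw [← sub_ext (mat f), h', sub_ext]⟩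
  -- A Karoubi morphism absorbs the idempotents on both sides, so it is the extension of its own
  -- restriction.
  have : Φ.Full := ⟨fun {X Y} u => by
    obtain ⟨f, hf⟩ := exists_hom (X := X) (Y := Y) u.hom.f.1 u.hom.f.2
    refine ⟨f, ?_⟩
    apply ObjectProperty.hom_ext
    apply Idempotents.Karoubi.Hom.ext
    apply Subtype.ext
    exact (congrArg ext hf).trans ((ext_sub _).trans (congrArg Subtype.val u.hom.comm))⟩
  have : Φ.EssSurj := ⟨by
    rintro ⟨_, n, rfl⟩
    obtain ⟨X, rfl⟩ := hdim n
    exact ⟨X, ⟨Iso.refl _⟩⟩⟩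
  have : Φ.IsEquivalence := { }
  exact ⟨Φ.asEquivalence.symm⟩

end Equivalence

end GaloisCPM

end

noncomputable section

namespace GaloisCPM

/-! ### Kraus forms of CPM morphisms. -/

section KrausForm

/-- The tensor product over the Galois group of a family of matrices, with the automorphisms applied
to the entries. -/
def foldFamily {k K : Type*} [Field k] [Field K] [Algebra k K] [FiniteDimensional k K] {m n : ℕ+}
    (f : (K ≃ₐ[k] K) → Matrix (Fin m) (Fin n) K) :
    Matrix (FoldIdx k K m) (FoldIdx k K n) K :=
  Matrix.of fun j i => ∏ g : K ≃ₐ[k] K, g (f g (j g) (i g))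

theorem foldFamily_mul {k K : Type*} [Field k] [Field K] [Algebra k K] [FiniteDimensional k K]
    {l m n : ℕ+} (f : (K ≃ₐ[k] K) → Matrix (Fin l) (Fin m) K)
    (f' : (K ≃ₐ[k] K) → Matrix (Fin m) (Fin n) K) :
    foldFamily f * foldFamily f' = foldFamily fun g => f g * f' g := by
  ext j i
  simp only [foldFamily, Matrix.mul_apply, Matrix.of_apply, map_sum, map_mul]
  rw [Fintype.prod_sum]
  simp only [Finset.prod_mul_distrib]

variable (k F : Type*) {K : Type*} [Field k] [Field F] [Field K] [Algebra k F] [Algebra F K]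
  [Algebra k K] [IsScalarTower k F K] [Normal k F] [FiniteDimensional k K] [FiniteDimensional k F]

/-- The matrices which are sums of tensor products over the Galois group `Gal(K/k)`, with one
summation index for the whole group and one for each coset of `Gal(K/F)`. -/
def HasKrausForm {m n : ℕ+} (M : Matrix (FoldIdx k K m) (FoldIdx k K n) K) : Prop :=
  ∃ (Z Y : Type) (_ : Fintype Z) (_ : Fintype Y) (_ : Nonempty Z)
    (f : Z → Y → Matrix (Fin m) (Fin n) K),
    M = ∑ z, ∑ y : (F ≃ₐ[k] F) → Y,
      foldFamily fun g : K ≃ₐ[k] K => f z (y (AlgEquiv.restrictNormalHom F g))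

/-- The effects which have the form of `HasKrausForm`. -/
def EffectHasKrausForm {n : ℕ+} (ξ : FoldIdx k K n → K) : Prop :=
  ∃ (Z Y : Type) (_ : Fintype Z) (_ : Fintype Y) (_ : Nonempty Z) (e : Z → Y → Fin n → K),
    ∀ i, ξ i = ∑ z, ∑ y : (F ≃ₐ[k] F) → Y,
      ∏ g : K ≃ₐ[k] K, g (e z (y (AlgEquiv.restrictNormalHom F g)) (i g))

variable {k F}

theorem sum_prod_arrow {ι Y Y' R : Type*} [Fintype ι] [DecidableEq ι] [Fintype Y] [Fintype Y']
    [AddCommMonoid R]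
    (φ : (ι → Y) → (ι → Y') → R) :
    ∑ y : ι → Y × Y', φ (fun t => (y t).1) (fun t => (y t).2) = ∑ y, ∑ y', φ y y' := by
  rw [← Fintype.sum_prod_type']
  exact Fintype.sum_equiv (Equiv.arrowProdEquivProdArrow _ _ _) _ _ fun _ => rfl

/-- Tensor products compose factor by factor, and two functions on `Gal(F/k)` with values in `Y` and
`Y'` are one function with values in `Y × Y'`. So both kinds of index simply pair up. -/
theorem HasKrausForm.mul {l m n : ℕ+} {M : Matrix (FoldIdx k K l) (FoldIdx k K m) K}
    {N : Matrix (FoldIdx k K m) (FoldIdx k K n) K} (hM : HasKrausForm k F M)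
    (hN : HasKrausForm k F N) : HasKrausForm k F (M * N) := by
  obtain ⟨Z, Y, _, _, _, f, rfl⟩ := hM
  obtain ⟨Z', Y', _, _, _, f', rfl⟩ := hN
  refine ⟨Z × Z', Y × Y', inferInstance, inferInstance, inferInstance,
    fun z y => f z.1 y.1 * f' z.2 y.2, ?_⟩
  rw [Fintype.sum_prod_type, Matrix.sum_mul]
  refine Finset.sum_congr rfl fun z _ => ?_
  rw [Matrix.mul_sum]
  refine Finset.sum_congr rfl fun z' _ => ?_
  rw [Matrix.sum_mul]
  simp only [Matrix.mul_sum, foldFamily_mul]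
  exact (sum_prod_arrow fun (y : (F ≃ₐ[k] F) → Y) (y' : (F ≃ₐ[k] F) → Y') =>
    foldFamily fun g : K ≃ₐ[k] K => f z (y (AlgEquiv.restrictNormalHom F g)) *
      f' z' (y' (AlgEquiv.restrictNormalHom F g))).symm

theorem EffectHasKrausForm.tensor {a b : ℕ+} {ξ : FoldIdx k K a → K} {ζ : FoldIdx k K b → K}
    (hξ : EffectHasKrausForm k F ξ) (hζ : EffectHasKrausForm k F ζ) :
    EffectHasKrausForm k F (effectTensor ξ ζ) := by
  obtain ⟨Z, Y, _, _, _, e, he⟩ := hξ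
  obtain ⟨Z', Y', _, _, _, e', he'⟩ := hζ
  refine ⟨Z × Z', Y × Y', inferInstance, inferInstance, inferInstance,
    fun z y p => e z.1 y.1 (pairEquiv a b p).1 * e' z.2 y.2 (pairEquiv a b p).2, fun i => ?_⟩
  rw [Fintype.sum_prod_type, effectTensor, he, he', Finset.sum_mul]
  refine Finset.sum_congr rfl fun z _ => ?_
  rw [Finset.mul_sum]
  refine Finset.sum_congr rfl fun z' _ => ?_
  rw [Finset.sum_mul_sum]
  simp only [map_mul, Finset.prod_mul_distrib]
  exact (sum_prod_arrow fun (y : (F ≃ₐ[k] F) → Y) (y' : (F ≃ₐ[k] F) → Y') =>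
    (∏ g : K ≃ₐ[k] K, g (e z (y (AlgEquiv.restrictNormalHom F g)) (i.fst g))) *
      ∏ g : K ≃ₐ[k] K, g (e' z' (y' (AlgEquiv.restrictNormalHom F g)) (i.snd g))).symm

theorem EffectHasKrausForm.hasKrausForm {a : ℕ+} {ξ : FoldIdx k K a → K}
    (hξ : EffectHasKrausForm k F ξ) (b : ℕ+) : HasKrausForm k F (effectTensorId ξ b) := by
  obtain ⟨Z, Y, _, _, _, e, he⟩ := hξ
  refine ⟨Z, Y, inferInstance, inferInstance, inferInstance,
    fun z y => Matrix.of fun j p =>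
      e z y (pairEquiv a b p).1 * if (pairEquiv a b p).2 = j then 1 else 0, ?_⟩
  ext j i
  simp only [effectTensorId, Matrix.of_apply, he, Matrix.sum_apply, foldFamily, map_mul,
    Finset.prod_mul_distrib]
  simp only [Finset.sum_mul]
  refine Finset.sum_congr rfl fun z _ => Finset.sum_congr rfl fun y _ => congrArg₂ _ rfl ?_
  split_ifs with h
  · exact (Finset.prod_eq_one fun g _ => by
      rw [if_pos (by exact congrFun h g), map_one]).symm
  · obtain ⟨g, hg⟩ := Function.ne_iff.1 h
    exact (Finset.prod_eq_zero (Finset.mem_univ g) (by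
      rw [if_neg (by exact hg), map_zero])).symm

theorem hasKrausForm_foldMatrix {m n : ℕ+} (f : Matrix (Fin m) (Fin n) K) :
    HasKrausForm k F (foldMatrix (k := k) f) := by
  refine ⟨Unit, Unit, inferInstance, inferInstance, inferInstance, fun _ _ => f, ?_⟩
  simp only [Finset.univ_unique, Finset.sum_const, Finset.card_singleton, one_smul]
  rfl

/-- Discarding is a sum of products of delta functions. The full group shares one summation index
among all automorphisms, in `Z`; `Gal(K/F)` has one for each coset, in `Y`; the trivial subgroup
imposes no condition and needs neither. -/
theorem effectHasKrausForm_discard_top (n : ℕ+) :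
    EffectHasKrausForm k F (discard (⊤ : Subgroup (K ≃ₐ[k] K)) n) := by
  have : Nonempty (Fin n) := ⟨⟨0, n.pos⟩⟩
  refine ⟨Fin n, Unit, inferInstance, inferInstance, inferInstance,
    fun z _ x => if z = x then 1 else 0, fun i => ?_⟩
  rw [discard_eq_sum FoldIdx.const_injective FoldIdx.exists_const_eq_iff]
  simp only [Finset.univ_unique, Finset.sum_singleton, apply_ite, map_one, map_zero]
  rfl

theorem effectHasKrausForm_discard_bot (n : ℕ+) :
    EffectHasKrausForm k F (discard (⊥ : Subgroup (K ≃ₐ[k] K)) n) := by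
  refine ⟨Unit, Unit, inferInstance, inferInstance, inferInstance, fun _ _ _ => 1, fun i => ?_⟩
  rw [discard_bot]
  simp

variable [Normal k K]

theorem effectHasKrausForm_discard_ker (n : ℕ+) :
    EffectHasKrausForm k F
      (discard (AlgEquiv.restrictNormalHom F : (K ≃ₐ[k] K) →* (F ≃ₐ[k] F)).ker n) := by
  refine ⟨Unit, Fin n, inferInstance, inferInstance, inferInstance,
    fun _ y x => if y = x then 1 else 0, fun i => ?_⟩
  rw [discard_eq_sum (FoldIdx.lift_injective (F := F)) FoldIdx.exists_lift_eq_iff]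
  simp only [Finset.univ_unique, Finset.sum_singleton, apply_ite, map_one, map_zero]
  rfl

theorem IsEnv.effectHasKrausForm
    (hsub : ∀ H : Subgroup (K ≃ₐ[k] K), H = ⊥ ∨ H = ⊤ ∨
      H = (AlgEquiv.restrictNormalHom F : (K ≃ₐ[k] K) →* (F ≃ₐ[k] F)).ker)
    {n : ℕ+} {ξ : FoldIdx k K n → K} (hξ : IsEnv ξ) :
    EffectHasKrausForm k F ξ := by
  induction hξ with
  | discard H n =>
    rcases hsub H with rfl | rfl | rfl
    · exact effectHasKrausForm_discard_bot n
    · exact effectHasKrausForm_discard_top n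
    · exact effectHasKrausForm_discard_ker n
  | tensor _ _ h h' => exact h.tensor h'

/-- If the only subgroups of the Galois group are the trivial ones and `Gal(K/F)` then all morphisms
of the CPM category have a Kraus form. -/
theorem IsCPM.hasKrausForm
    (hsub : ∀ H : Subgroup (K ≃ₐ[k] K), H = ⊥ ∨ H = ⊤ ∨
      H = (AlgEquiv.restrictNormalHom F : (K ≃ₐ[k] K) →* (F ≃ₐ[k] F)).ker)
    {S : Subsemiring K} {m n : ℕ+}
    {M : Matrix (FoldIdx k K m) (FoldIdx k K n) K} (hM : IsCPM k S M) : HasKrausForm k F M := by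
  induction hM with
  | fold f _ => exact hasKrausForm_foldMatrix f
  | effect hξ b => exact (hξ.effectHasKrausForm hsub).hasKrausForm b
  | comp _ _ h h' => exact h'.mul h

/-- The entries of a matrix in Kraus form at the families which are lifted from `Gal(F/k)`. -/
theorem HasKrausForm.exists_apply_eq_sum_norm [FiniteDimensional F K] [IsGalois F K]
    {m n : ℕ+} {M : Matrix (FoldIdx k K m) (FoldIdx k K n) K} (hM : HasKrausForm k F M) :
    ∃ (Z Y : Type) (_ : Fintype Z) (_ : Fintype Y) (_ : Nonempty Z)
      (f : Z → Y → Matrix (Fin m) (Fin n) K), ∀ (j : FoldIdx k F m) (i : FoldIdx k F n),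
      M (j.lift K) (i.lift K) = algebraMap F K (∑ z, ∏ t : F ≃ₐ[k] F,
        t (∑ y, Algebra.norm F (f z y (j t) (i t)))) := by
  obtain ⟨Z, Y, _, _, _, f, rfl⟩ := hM
  refine ⟨Z, Y, inferInstance, inferInstance, inferInstance, f, fun j i => ?_⟩
  simp only [Matrix.sum_apply, foldFamily, Matrix.of_apply, map_sum (algebraMap F K)]
  exact Finset.sum_congr rfl fun z _ =>
    sum_prod_galois_eq_prod_sum_norm fun y t => f z y (j t) (i t)

end KrausForm

/-! ### Transfer of CPM morphisms between `K/k` and `F/k`. -/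

section Lift

/-- Finitely many sums of values of a function which vanishes at `0` can be written with the same
number of summands. -/
theorem exists_uniform_sum {A B R : Type*} [Finite A] [Zero B] [AddCommMonoid R] (ν : B → R)
    (h0 : ν 0 = 0) (x : A → R) (hx : ∀ a, x a ∈ AddSubmonoid.closure (Set.range ν)) :
    ∃ (N : ℕ+) (v : Fin N → A → B), ∀ a, ∑ y, ν (v y a) = x a := by
  -- Short lists are padded with the default `0`, which contributes nothing because `ν 0 = 0`.
  have aux (l : List B) : ∀ N : ℕ, l.length ≤ N →
      ∑ y : Fin N, ν (l.getD y 0) = (l.map ν).sum := by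
    induction l with
    | nil => simp [h0]
    | cons b l ih =>
      rintro (_ | N) hN
      · simp at hN
      · rw [Fin.sum_univ_succ, List.map_cons, List.sum_cons, ← ih N (by simpa using hN)]
        simp
  have hl (a : A) : ∃ l : List B, (l.map ν).sum = x a := by
    obtain ⟨l, hl, h⟩ := AddSubmonoid.exists_list_of_mem_closure (hx a)
    choose! φ hφ using fun r (hr : r ∈ l) => hl r hr
    refine ⟨l.map φ, ?_⟩
    rw [List.map_map, ← h, List.map_congr_left (f := ν ∘ φ) (g := id) hφ, List.map_id]
  choose l hl using hl
  have := Fintype.ofFinite A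
  -- The total length bounds every list; the `+ 1` makes the number of summands positive even if all
  -- lists are empty.
  refine ⟨⟨(∑ a, (l a).length) + 1, Nat.succ_pos _⟩, fun y a => (l a).getD y 0, fun a => ?_⟩
  rw [← hl a]
  exact aux _ _ ((Finset.single_le_sum (f := fun a => (l a).length) (fun _ _ => Nat.zero_le _)
    (Finset.mem_univ a)).trans (Nat.le_succ _))

variable {k F K : Type*} [Field k] [Field F] [Field K] [Algebra k F] [Algebra F K]
  [Algebra k K] [IsScalarTower k F K] [Normal k F] [FiniteDimensional k K] [FiniteDimensional k F]
  [Normal k K]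

theorem discard_comap_lift (H : Subgroup (F ≃ₐ[k] F)) {n : ℕ+} (i : FoldIdx k F n) :
    discard (H.comap (AlgEquiv.restrictNormalHom F : (K ≃ₐ[k] K) →* (F ≃ₐ[k] F))) n (i.lift K) =
      algebraMap F K (discard H n i) := by
  have hs := AlgEquiv.restrictNormalHom_surjective (F := k) (K₁ := F) K
  rw [discard, discard, apply_ite (algebraMap F K), map_one, map_zero]
  congr 1
  refine propext ⟨fun h g x hx => ?_, fun h g x hx => ?_⟩
  · obtain ⟨g, rfl⟩ := hs g
    obtain ⟨x, rfl⟩ := hs x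
    simpa [FoldIdx.lift] using h g x hx
  · simpa [FoldIdx.lift] using h (AlgEquiv.restrictNormalHom F g) (AlgEquiv.restrictNormalHom F x) hx

theorem IsEnv.exists_lift {n : ℕ+} {ξ : FoldIdx k F n → F} (hξ : IsEnv ξ) :
    ∃ ξ' : FoldIdx k K n → K, IsEnv ξ' ∧ ∀ i : FoldIdx k F n, ξ' (i.lift K) =
      algebraMap F K (ξ i) := by
  induction hξ with
  | discard H n => exact ⟨_, IsEnv.discard _ n, discard_comap_lift H⟩
  | tensor _ _ h h' =>
    obtain ⟨ξ, hξ, h⟩ := h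
    obtain ⟨ζ, hζ, h'⟩ := h'
    refine ⟨_, hξ.tensor hζ, fun i => ?_⟩
    rw [effectTensor, effectTensor, map_mul, ← h, ← h']
    rfl

/-- Induction on `IsCPM` would fail at composition, where the intermediate families need not be
lifted. The Kraus form avoids this: its restriction is a sum over `z` of foldings of matrices whose
entries are sums of norms. -/
theorem isCPM_restrict {S : Subsemiring F} [FiniteDimensional F K] [IsGalois F K]
    (hsub : ∀ H : Subgroup (K ≃ₐ[k] K), H = ⊥ ∨ H = ⊤ ∨
      H = (AlgEquiv.restrictNormalHom F : (K ≃ₐ[k] K) →* (F ≃ₐ[k] F)).ker)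
    (hS : ∀ w : K, Algebra.norm F w ∈ S) {T : Subsemiring K} {m n : ℕ+}
    {M : Matrix (FoldIdx k K m) (FoldIdx k K n) K} (hM : IsCPM k T M) :
    ∃ M' : Matrix (FoldIdx k F m) (FoldIdx k F n) F, IsCPM k S M' ∧
      ∀ j i, M (j.lift K) (i.lift K) = algebraMap F K (M' j i) := by
  obtain ⟨Z, Y, _, _, _, f, hf⟩ := (hM.hasKrausForm hsub).exists_apply_eq_sum_norm
  refine ⟨_, isCPM_sum_foldMatrix
    (fun z => Matrix.of fun j i => ∑ y, Algebra.norm F (f z y j i)) ?_, fun j i => ?_⟩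
  · exact fun z j i => sum_mem fun y _ => hS _
  · rw [hf, Matrix.sum_apply]
    rfl

theorem IsCPM.exists_lift {S : Subsemiring F} [FiniteDimensional F K] [IsGalois F K]
    (hS : ∀ x ∈ S, x ∈ AddSubmonoid.closure (Set.range (Algebra.norm F : K → F))) {m n : ℕ+}
    {M : Matrix (FoldIdx k F m) (FoldIdx k F n) F} (hM : IsCPM k S M) :
    ∃ M' : Matrix (FoldIdx k K m) (FoldIdx k K n) K, IsCPM k ⊤ M' ∧
      ∀ j i, M' (j.lift K) (i.lift K) = algebraMap F K (M j i) := by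
  induction hM with
  | @fold n m f hf =>
    obtain ⟨N, v, hv⟩ := exists_uniform_sum (Algebra.norm F : K → F) (Algebra.norm_zero)
      (fun p : Fin m × Fin n => f p.1 p.2) fun p => hS _ (hf _ _)
    -- The summation index of the norms becomes an extra output. Discarding it with respect to
    -- `Gal(K/F)` lets it vary with `t`, as the expansion of `∏_t t(∑_y N(v_y))` requires.
    let f' : Matrix (Fin (N * m : ℕ+)) (Fin n) K :=
      Matrix.of fun p i => v (pairEquiv N m p).1 ((pairEquiv N m p).2, i)
    refine ⟨_, (IsCPM.fold (S := ⊤) f' fun _ _ => trivial).comp (IsCPM.effect (IsEnv.discard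
      (AlgEquiv.restrictNormalHom F : (K ≃ₐ[k] K) →* (F ≃ₐ[k] F)).ker N) m), fun j i => ?_⟩
    refine (effectTensorId_mul_apply _ _ _ _).trans ?_
    rw [sum_discard_mul (FoldIdx.lift_injective (F := F)) FoldIdx.exists_lift_eq_iff]
    refine Eq.trans ?_ ((sum_prod_galois_eq_prod_sum_norm
      fun (y : Fin N) (t : F ≃ₐ[k] F) => v y (j t, i t)).trans ?_)
    · refine Finset.sum_congr rfl fun y _ => Finset.prod_congr rfl fun g _ => congrArg g ?_
      simp only [f', Matrix.of_apply]
      rw [show pairEquiv N m ((FoldIdx.lift K y).pair (j.lift K) g) =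
        (FoldIdx.lift K y g, j.lift K g) from (pairEquiv N m).apply_symm_apply _]
      rfl
    · refine congrArg _ (Finset.prod_congr rfl fun t _ => congrArg t (hv (j t, i t)))
  | effect hξ b =>
    obtain ⟨ξ', hξ', h⟩ := hξ.exists_lift (K := K)
    refine ⟨_, IsCPM.effect hξ' b, fun j i => ?_⟩
    rw [effectTensorId, effectTensorId, Matrix.of_apply, Matrix.of_apply, map_mul, ← h,
      apply_ite (algebraMap F K), map_one, map_zero]
    refine congrArg₂ _ rfl (if_congr ?_ rfl rfl)
    exact (FoldIdx.lift_injective (K := K)).eq_iff (a := i.snd)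
  | comp _ _ h h' =>
    obtain ⟨f', hf', h⟩ := h
    obtain ⟨g', hg', h'⟩ := h'
    -- Decoherence between the two lifts confines the intermediate sum to lifted families.
    refine ⟨_, (hf'.comp (isCPM_decoherence _
      (AlgEquiv.restrictNormalHom F : (K ≃ₐ[k] K) →* (F ≃ₐ[k] F)).ker _)).comp hg', fun j i => ?_⟩
    rw [Matrix.mul_apply, Matrix.mul_apply, map_sum]
    simp only [decoherence, Matrix.diagonal_mul, mul_left_comm (g' _ _)]
    rw [sum_discard_mul (FoldIdx.lift_injective (F := F)) FoldIdx.exists_lift_eq_iff]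
    exact Finset.sum_congr rfl fun e _ => by rw [map_mul, h, h']

end Lift

end GaloisCPM

end

noncomputable section

namespace GaloisCPM

/-! ### Totally positive elements, norms and sums of powers. -/

section TotallyPositive

/-- For `q = a/b`, the element `q v ^ e` is the sum of `a b ^ (e - 1)` copies of `(v/b) ^ e`. -/
theorem algebraMap_mul_pow_mem_closure {F : Type*} [Field F] [CharZero F] {e : ℕ} (he : e ≠ 0)
    {q : ℚ} (hq : 0 ≤ q) (v : F) :
    algebraMap ℚ F q * v ^ e ∈ AddSubmonoid.closure (Set.range fun x : F => x ^ e) := by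
  have h : algebraMap ℚ F q * v ^ e = (q.num.toNat * q.den ^ (e - 1)) • (v / q.den) ^ e := by
    have hd : (q.den : F) ≠ 0 := Nat.cast_ne_zero.2 q.den_nz
    have hn : ((q.num.toNat : ℕ) : F) = (q.num : F) := by
      rw [← Int.cast_natCast, Int.toNat_of_nonneg (Rat.num_nonneg.2 hq)]
    obtain ⟨e, rfl⟩ := Nat.exists_eq_succ_of_ne_zero he
    rw [nsmul_eq_mul, eq_ratCast, Rat.cast_def, Nat.cast_mul, hn, Nat.succ_sub_one, Nat.cast_pow,
      div_pow]
    rw [Nat.succ_eq_add_one, pow_succ (q.den : F)]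
    field_simp
  rw [h]
  exact nsmul_mem (AddSubmonoid.subset_closure (Set.mem_range_self (v / q.den))) _

theorem mem_totallyPositive_rat {q : ℚ} : q ∈ totallyPositive ℚ ↔ 0 ≤ q := by
  constructor
  · intro h
    simpa using h (algebraMap ℚ ℝ)
  · intro h σ
    rw [Subsingleton.elim σ (algebraMap ℚ ℝ)]
    simpa using h

/-- The relative norm of a totally complex quadratic extension has totally positive values. -/
theorem norm_mem_totallyPositive {F K : Type*} [Field F] [Field K] [CharZero F] [Algebra F K]
    [FiniteDimensional F K] (h2 : Module.finrank F K = 2) (hK : IsEmpty (K →+* ℝ)) (w : K) :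
    Algebra.norm F w ∈ totallyPositive F := by
  intro τ
  let _ : Algebra F ℂ := (Complex.ofRealHom.comp τ).toAlgebra
  have hτ (x : F) : algebraMap F ℂ x = (τ x : ℂ) := rfl
  obtain ⟨σ⟩ : Nonempty (K →ₐ[F] ℂ) := ⟨IsAlgClosed.lift⟩
  -- An extension of `τ` equal to its complex conjugate would be a real embedding of `K`. So the two
  -- extensions are `σ` and its conjugate, and the norm maps to `|σ w|²`.
  let σ' : K →ₐ[F] ℂ :=
    { (starRingEnd ℂ).comp (σ : K →+* ℂ) with
      commutes' := fun x => by
        change (starRingEnd ℂ) (σ (algebraMap F K x)) = _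
        rw [σ.commutes, hτ, Complex.conj_ofReal] }
  have hne : σ ≠ σ' := by
    intro h
    have hσ (x : K) : ((σ x).re : ℂ) = σ x :=
      Complex.conj_eq_iff_re.1 (AlgHom.congr_fun h x).symm
    refine hK.false
      { toFun := fun x => (σ x).re
        map_one' := by simp
        map_zero' := by simp
        map_add' := fun x y => by simp
        map_mul' := fun x y => ?_ }
    apply Complex.ofReal_injective
    rw [Complex.ofReal_mul, hσ, hσ, hσ, map_mul]
  classical
  have huniv : (Finset.univ : Finset (K →ₐ[F] ℂ)) = {σ, σ'} :=
    (Finset.eq_univ_of_card _ (by rw [Finset.card_pair hne, AlgHom.card, h2])).symm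
  have h := Algebra.norm_eq_prod_embeddings F ℂ w
  rw [huniv, Finset.prod_pair hne, hτ] at h
  have h' : σ w * σ' w = (Complex.normSq (σ w) : ℂ) := Complex.mul_conj (σ w)
  rw [h', Complex.ofReal_inj] at h
  rw [h]
  exact Complex.normSq_nonneg _

/-- Every `τ ∘ t` is again a real embedding, so `τ` sends each conjugate of `x` to a nonnegative
number. -/
theorem norm_mem_totallyPositive_rat {F : Type*} [Field F] [NumberField F] [IsGalois ℚ F]
    (τ : F →+* ℝ) {x : F} (hx : x ∈ totallyPositive F) :
    Algebra.norm ℚ x ∈ totallyPositive ℚ := by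
  intro σ
  rw [Subsingleton.elim σ (τ.comp (algebraMap ℚ F)), RingHom.comp_apply,
    Algebra.norm_eq_prod_automorphisms, map_prod]
  exact Finset.prod_nonneg fun t _ => hx (τ.comp (t : F →+* F))

/-- Totally positive elements `x` of a real quadratic field are sums of squares, because of
`Tr(x) x = x ^ 2 + N(x)`. -/
theorem mem_closure_sq_of_mem_totallyPositive {F : Type*} [Field F] [NumberField F] [IsGalois ℚ F]
    (h2 : Module.finrank ℚ F = 2) (τ : F →+* ℝ) {x : F} (hx : x ∈ totallyPositive F) :
    x ∈ AddSubmonoid.closure (Set.range fun x : F => x ^ 2) := by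
  by_cases hx0 : x = 0
  · rw [hx0]
    exact zero_mem _
  have hcard : Nat.card (F ≃ₐ[ℚ] F) = 2 := by rw [IsGalois.card_aut_eq_finrank, h2]
  obtain ⟨t, ht, -⟩ := (Nat.card_eq_two_iff' (1 : F ≃ₐ[ℚ] F)).1 hcard
  have huniv : (Finset.univ : Finset (F ≃ₐ[ℚ] F)) = {1, t} :=
    (Finset.eq_univ_of_card _ (by
      rw [Finset.card_pair ht.symm, ← Nat.card_eq_fintype_card, hcard])).symm
  have htr := trace_eq_sum_automorphisms (K := ℚ) x
  have hnm := Algebra.norm_eq_prod_automorphisms ℚ x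
  rw [huniv, Finset.sum_pair ht.symm, AlgEquiv.one_apply] at htr
  rw [huniv, Finset.prod_pair ht.symm, AlgEquiv.one_apply] at hnm
  have hn := mem_totallyPositive_rat.1 (norm_mem_totallyPositive_rat τ hx)
  have htpos : 0 < Algebra.trace ℚ F x := by
    have : (0 : ℝ) < τ (algebraMap ℚ F (Algebra.trace ℚ F x)) := by
      rw [htr, map_add]
      exact add_pos_of_pos_of_nonneg
        (((mem_totallyPositive_iff x).1 hx).resolve_left hx0 τ) (hx (τ.comp (t : F →+* F)))
    simpa using this
  have h0 : algebraMap ℚ F (Algebra.trace ℚ F x) ≠ 0 := by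
    rw [map_ne_zero]
    exact htpos.ne'
  -- After division by the positive trace, both squares have nonnegative rational coefficients, and
  -- these are absorbed into sums of squares.
  have key : x = algebraMap ℚ F (Algebra.trace ℚ F x)⁻¹ * x ^ 2 +
      algebraMap ℚ F (Algebra.norm ℚ x * (Algebra.trace ℚ F x)⁻¹) * 1 ^ 2 := by
    rw [map_mul, map_inv₀]
    field_simp
    rw [hnm, htr]
    ring
  rw [key]
  exact add_mem (algebraMap_mul_pow_mem_closure two_ne_zero (inv_nonneg.2 htpos.le) _)
    (algebraMap_mul_pow_mem_closure two_ne_zero (mul_nonneg hn (inv_nonneg.2 htpos.le)) _)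

end TotallyPositive

/-! ### Subfields and Galois group of `ℚ(ζ₅)`. -/

section Cyclotomic

variable {K : Type*} [Field K] [NumberField K]

theorem minpoly_sqrt_five {s : K} (hs : s ^ 2 = 5) :
    minpoly ℚ s = Polynomial.X ^ 2 - Polynomial.C 5 := by
  refine (minpoly.eq_of_irreducible_of_monic
    (X_pow_sub_C_irreducible_of_prime Nat.prime_two fun b hb => ?_) ?_
    (Polynomial.monic_X_pow_sub_C _ two_ne_zero)).symm
  · have : IsSquare (5 : ℚ) := ⟨b, by rw [← hb, sq]⟩
    norm_num at this
  · simp [hs]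

open scoped IntermediateField

theorem finrank_adjoin_sqrt_five {s : K} (hs : s ^ 2 = 5) : Module.finrank ℚ ℚ⟮s⟯ = 2 := by
  have h := IntermediateField.adjoin.finrank (Algebra.IsIntegral.isIntegral (R := ℚ) s)
  rw [minpoly_sqrt_five hs, Polynomial.natDegree_X_pow_sub_C] at h
  exact h

theorem nonempty_real_embedding_adjoin_sqrt_five {s : K} (hs : s ^ 2 = 5) : Nonempty (ℚ⟮s⟯ →+* ℝ) := by
  have h := (IntermediateField.algHomAdjoinIntegralEquiv ℚ (K := ℝ)
    (Algebra.IsIntegral.isIntegral (R := ℚ) s)).symm ⟨√5, by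
      rw [minpoly_sqrt_five hs, Polynomial.mem_aroots]
      exact ⟨Polynomial.X_pow_sub_C_ne_zero two_pos _, by simp⟩⟩
  exact ⟨h⟩

theorem ker_restrictNormalHom_eq_fixingSubgroup (F : IntermediateField ℚ K) [Normal ℚ F] :
    (AlgEquiv.restrictNormalHom F : (K ≃ₐ[ℚ] K) →* (F ≃ₐ[ℚ] F)).ker = F.fixingSubgroup :=
  Subgroup.ext fun g => by
    rw [MonoidHom.mem_ker, IntermediateField.mem_fixingSubgroup_iff]
    constructor
    · intro h x hx
      exact (algebraMap_restrictNormalHom g (⟨x, hx⟩ : F)).symm.trans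
        (congrArg (algebraMap F K) (AlgEquiv.congr_fun h _))
    · intro h
      ext x
      exact (algebraMap_restrictNormalHom g x).trans (h x x.2)

variable [IsCyclotomicExtension {5} ℚ K]

/-- The Galois group is `(ℤ/5)ˣ`, which contains only one involution. -/
theorem subgroup_eq_of_card_eq_two (H H' : Subgroup (K ≃ₐ[ℚ] K)) (hH : Nat.card H = 2)
    (hH' : Nat.card H' = 2) : H ≤ H' := by
  have key : ∀ a b : (ZMod 5)ˣ, a ^ 2 = 1 → b ^ 2 = 1 → a ≠ 1 → b ≠ 1 → a = b := by decide
  let e := IsCyclotomicExtension.Rat.galEquivZMod 5 K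
  obtain ⟨b, hb, -⟩ := (Nat.card_eq_two_iff' (1 : H')).1 hH'
  intro a ha
  by_cases ha1 : a = 1
  · rw [ha1]
    exact H'.one_mem
  have ha2 : a ^ 2 = 1 := by
    have := pow_card_eq_one' (x := (⟨a, ha⟩ : H))
    rw [hH] at this
    exact congrArg Subtype.val this
  have hb2 : (b : K ≃ₐ[ℚ] K) ^ 2 = 1 := by
    have := pow_card_eq_one' (x := b)
    rw [hH'] at this
    exact congrArg Subtype.val this
  have hab : a = b := e.injective (key _ _ (by rw [← map_pow, ha2, map_one])
    (by rw [← map_pow, hb2, map_one]) (by simpa using ha1) (by simpa using hb))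
  rw [hab]
  exact b.2

theorem card_galois : Nat.card (K ≃ₐ[ℚ] K) = 4 := by
  have := IsCyclotomicExtension.isGalois {5} ℚ K
  rw [IsGalois.card_aut_eq_finrank, IsCyclotomicExtension.Rat.finrank 5 K]
  rfl

theorem subgroup_trichotomy {H' : Subgroup (K ≃ₐ[ℚ] K)} (hH' : Nat.card H' = 2)
    (H : Subgroup (K ≃ₐ[ℚ] K)) : H = ⊥ ∨ H = ⊤ ∨ H = H' := by
  have hd : Nat.card H ∣ 2 ^ 2 := by
    rw [show 2 ^ 2 = 4 from rfl, ← card_galois (K := K)]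
    exact H.card_subgroup_dvd_card
  obtain ⟨m, hm, h⟩ := (Nat.dvd_prime_pow Nat.prime_two).1 hd
  interval_cases m
  · exact Or.inl (Subgroup.card_eq_one.1 h)
  · exact Or.inr (Or.inr (le_antisymm (subgroup_eq_of_card_eq_two _ _ h hH')
      (subgroup_eq_of_card_eq_two _ _ hH' h)))
  · exact Or.inr (Or.inl (Subgroup.eq_top_of_card_eq _ (by rw [h, card_galois]; rfl)))

-- The map `x ↦ x ^ 5` is strictly increasing on `ℝ`, so the only real fifth root of unity is `1`.
variable (K) in
theorem isEmpty_real_embedding : IsEmpty (K →+* ℝ) := by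
  refine ⟨fun σ => ?_⟩
  have hζ := (IsCyclotomicExtension.zeta_spec 5 ℚ K).map_of_injective σ.injective
  have h1 : σ (IsCyclotomicExtension.zeta 5 ℚ K) = 1 :=
    (Odd.strictMono_pow (by decide : Odd 5)).injective (by
      simpa using hζ.pow_eq_one)
  exact hζ.ne_one (by norm_num) h1

theorem finrank_over_adjoin_sqrt_five {s : K} (hs : s ^ 2 = 5) : Module.finrank ℚ⟮s⟯ K = 2 := by
  have h := Module.finrank_mul_finrank ℚ ℚ⟮s⟯ K
  rw [finrank_adjoin_sqrt_five hs, IsCyclotomicExtension.Rat.finrank 5 K,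
    show Nat.totient 5 = 4 from rfl] at h
  omega

theorem isGalois_intermediateField (F : IntermediateField ℚ K) : IsGalois ℚ F := by
  have := IsCyclotomicExtension.isAbelianGalois {5} ℚ K
  have := IsAbelianGalois.tower_bot ℚ F K
  infer_instance

end Cyclotomic

end GaloisCPM

end

noncomputable section

namespace GaloisCPM

/-! ### The two equivalences. -/

section Main

open scoped IntermediateField

variable {K : Type*} [Field K] [NumberField K] [IsCyclotomicExtension {5} ℚ K] {s : K}

theorem subgroup_eq_bot_or_top_or_ker (hs : s ^ 2 = 5) [Normal ℚ ℚ⟮s⟯]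
    (H : Subgroup (K ≃ₐ[ℚ] K)) : H = ⊥ ∨ H = ⊤ ∨
      H = (AlgEquiv.restrictNormalHom ℚ⟮s⟯ : (K ≃ₐ[ℚ] K) →* (ℚ⟮s⟯ ≃ₐ[ℚ] ℚ⟮s⟯)).ker := by
  have := IsCyclotomicExtension.isGalois {5} ℚ K
  refine subgroup_trichotomy ?_ H
  rw [ker_restrictNormalHom_eq_fixingSubgroup, IsGalois.card_fixingSubgroup_eq_finrank,
    finrank_over_adjoin_sqrt_five hs]

theorem nonempty_equivalence_matCat (hs : s ^ 2 = 5) :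
    Nonempty ((IsDecoherence (⊥ : IntermediateField ℚ K)).FullSubcategory ≌
      MatCat (totallyPositive ℚ)) := by
  have := IsCyclotomicExtension.isGalois {5} ℚ K
  have := isGalois_intermediateField ℚ⟮s⟯
  have : IsGalois ℚ⟮s⟯ K := IsGalois.tower_top_of_isGalois ℚ ℚ⟮s⟯ K
  obtain ⟨τ⟩ := nonempty_real_embedding_adjoin_sqrt_five hs
  let ι : totallyPositive ℚ →+* K := (algebraMap ℚ K).comp (totallyPositive ℚ).subtype
  have hι : Function.Injective ι := (algebraMap ℚ K).injective.comp Subtype.val_injective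
  refine nonempty_decoherence_equivalence ⊥ MatCat.dim (fun n => ⟨⟨n⟩, rfl⟩)
    (J := fun n => Fin n) (fun n => FoldIdx.const ℚ K) (fun n => FoldIdx.const_injective)
    (fun n i => ?_) (fun {X Y} f =>
      (show Matrix (Fin Y.dim) (Fin X.dim) (totallyPositive ℚ) from f).map ι)
    ?_ (fun X => ?_) (fun {X Y Z} f g => ?_) (fun {X Y} f => ?_) (fun {X Y} M hM => ?_)
  · rw [IntermediateField.fixingSubgroup_bot]
    exact FoldIdx.exists_const_eq_iff i
  · exact fun {X Y} f g h => Matrix.map_injective hι h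
  · exact Matrix.map_one _ (map_zero ι) (map_one ι)
  · exact Matrix.map_mul
  · let A : Matrix (Fin Y.dim) (Fin X.dim) (totallyPositive ℚ) := f
    -- The exponent is the order of the Galois group: automorphisms fix rationals, so folding `v`
    -- gives `v ^ 4` at constant families.
    obtain ⟨N, v, hv⟩ := exists_uniform_sum (fun x : ℚ => x ^ 4) (zero_pow four_ne_zero)
      (fun p : Fin Y.dim × Fin X.dim => (A p.1 p.2 : ℚ)) fun p => by
        simpa using algebraMap_mul_pow_mem_closure four_ne_zero
          (mem_totallyPositive_rat.1 (A p.1 p.2).2) (1 : ℚ)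
    have : Nonempty (Fin N) := ⟨⟨0, N.pos⟩⟩
    refine ⟨_, isCPM_sum_foldMatrix (fun z => Matrix.of fun j i => algebraMap ℚ K (v z (j, i)))
      fun _ _ _ => trivial, ?_⟩
    ext j i
    change _ = algebraMap ℚ K (A j i : ℚ)
    rw [← hv (j, i), map_sum, Matrix.submatrix_apply, Matrix.sum_apply]
    refine Finset.sum_congr rfl fun z _ => ?_
    simp only [foldMatrix, Matrix.of_apply, FoldIdx.const, AlgEquiv.commutes, Finset.prod_const,
      Finset.card_univ, map_pow]
    rw [← Nat.card_eq_fintype_card, card_galois]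
  · obtain ⟨Z, Y', _, _, _, f, hf⟩ :=
      (hM.hasKrausForm (subgroup_eq_bot_or_top_or_ker hs)).exists_apply_eq_sum_norm
    let A : Matrix (Fin Y.dim) (Fin X.dim) (totallyPositive ℚ) := Matrix.of fun j i =>
      ∑ z, ⟨Algebra.norm ℚ (∑ y, Algebra.norm ℚ⟮s⟯ (f z y j i)),
        norm_mem_totallyPositive_rat τ (sum_mem fun y _ => norm_mem_totallyPositive
          (finrank_over_adjoin_sqrt_five hs) (isEmpty_real_embedding K) _)⟩
    refine ⟨A, ?_⟩
    ext j i
    -- Constant families are lifts of constant families, so the formula over `ℚ(√5)` applies, and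
    -- its product over `t` is the norm to `ℚ`.
    refine Eq.trans ?_ (hf (FoldIdx.const ℚ ℚ⟮s⟯ j) (FoldIdx.const ℚ ℚ⟮s⟯ i)).symm
    change ι (A j i) = _
    simp only [A, Matrix.of_apply, map_sum ι, map_sum (algebraMap ℚ⟮s⟯ K)]
    refine Finset.sum_congr rfl fun z _ => ?_
    change algebraMap ℚ K (Algebra.norm ℚ _) = _
    rw [IsScalarTower.algebraMap_apply ℚ ℚ⟮s⟯ K, Algebra.norm_eq_prod_automorphisms]
    rfl

theorem nonempty_equivalence_cpm (hs : s ^ 2 = 5) :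
    Nonempty ((IsDecoherence ℚ⟮s⟯).FullSubcategory ≌ CPM ℚ (totallyPositive ℚ⟮s⟯)) := by
  have := IsCyclotomicExtension.isGalois {5} ℚ K
  have := isGalois_intermediateField ℚ⟮s⟯
  have : IsGalois ℚ⟮s⟯ K := IsGalois.tower_top_of_isGalois ℚ ℚ⟮s⟯ K
  have : Normal ℚ ℚ⟮s⟯ := IsGalois.to_normal
  have hK := finrank_over_adjoin_sqrt_five hs
  obtain ⟨τ⟩ := nonempty_real_embedding_adjoin_sqrt_five hs
  have hι : Function.Injective (algebraMap ℚ⟮s⟯ K) := (algebraMap ℚ⟮s⟯ K).injective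
  refine nonempty_decoherence_equivalence ℚ⟮s⟯ CPM.dim (fun n => ⟨⟨n⟩, rfl⟩)
    (J := FoldIdx ℚ ℚ⟮s⟯) (fun n => FoldIdx.lift K) (fun n => FoldIdx.lift_injective)
    (fun n i => ?_) (fun f => f.1.map (algebraMap ℚ⟮s⟯ K))
    ?_ (fun X => ?_) (fun {X Y Z} f g => ?_) (fun {X Y} f => ?_) (fun {X Y} M hM => ?_)
  · rw [← ker_restrictNormalHom_eq_fixingSubgroup]
    exact FoldIdx.exists_lift_eq_iff i
  · exact fun {X Y} f g h => Subtype.ext (Matrix.map_injective hι h)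
  · exact Matrix.map_one _ (map_zero _) (map_one _)
  · exact Matrix.map_mul
  · obtain ⟨M, hM, h⟩ := f.2.exists_lift (K := K) fun x hx => by
      refine AddSubmonoid.closure_mono ?_
        (mem_closure_sq_of_mem_totallyPositive (finrank_adjoin_sqrt_five hs) τ hx)
      -- In degree 2 the square of `v` is the relative norm of `v` itself.
      rintro _ ⟨v, rfl⟩
      exact ⟨algebraMap ℚ⟮s⟯ K v, by rw [Algebra.norm_algebraMap, hK]⟩
    exact ⟨M, hM, Matrix.ext h⟩
  · obtain ⟨M', hM', h⟩ := isCPM_restrict (S := totallyPositive ℚ⟮s⟯)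
      (subgroup_eq_bot_or_top_or_ker hs)
      (norm_mem_totallyPositive hK (isEmpty_real_embedding K)) hM
    exact ⟨⟨M', hM'⟩, Matrix.ext fun j i => (h j i).symm⟩

end Main

end GaloisCPM

end

open scoped IntermediateField in
theorem mainTheorem1 (K : Type*) [Field K] [NumberField K] [IsCyclotomicExtension {5} ℚ K]
    (s : K) (hs : s ^ 2 = 5) :
    Nonempty ((GaloisCPM.IsDecoherence (⊥ : IntermediateField ℚ K)).FullSubcategory ≌
      GaloisCPM.MatCat (GaloisCPM.totallyPositive ℚ)) ∧
    Nonempty ((GaloisCPM.IsDecoherence ℚ⟮s⟯).FullSubcategory ≌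
      GaloisCPM.CPM ℚ (GaloisCPM.totallyPositive ℚ⟮s⟯)) :=
  ⟨GaloisCPM.nonempty_equivalence_matCat hs, GaloisCPM.nonempty_equivalence_cpm hs⟩
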